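/- Let $t_{\max}\in\mathbb R$, let $a\colon(-\infty,t_{\max})\to(0,\infty)$ be smooth, and let $(M,g)$ be the flat FLRW spacetime $M=(-\infty,t_{\max})\times\mathbb R^3$, $g=-dt^2+a(t)^2(dx^2+dy^2+dz^2)$, time oriented by declaring $\partial_t$ future directed. Write $H=\dot a/a$. Let $h,\varepsilon>0$ and suppose that, as $t\to-\infty$, $$a(t)=e^{ht}+o\big(e^{(2+\varepsilon)ht}\big)\quad\text{and}\quad \dot a(t)=he^{ht}+o\big(e^{(2+\varepsilon)ht}\big).$$ Fix any $t_{\mathrm L}<t_{\max}$ and put $$\lambda(t)=\int_{-\infty}^t a(s)\,ds,\qquad \eta(t)=-\int_t^{t_{\mathrm L}}\frac{ds}{a(s)},\qquad v=\eta(t)+r,$$ where $r=|x|$; on the part $r>0$ of $M$ use the coordinates $(\lambda,v,\omega)$ with $\omega=x/|x|\in\mathbb S^2$, whose image is denoted $U\times\mathbb S^2\subset(0,\infty)\times\mathbb R\times\mathbb S^2$. Then: (a) $(M,g)$ admits a $C^1$ extension through the hypersurface $\{\lambda=0\}$. (b) If in addition $\lim_{t\to-\infty}\dot H(t)/a(t)^2$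 exists and is finite, then $(M,g)$ admits a $C^2$ extension through the hypersurface $\{\lambda=0\}$. Here "$(M,g)$ admits a $C^k$ extension through the hypersurface $\{\lambda=0\}$" means: there are a connected open neighbourhood $V$ of $\{0\}\times\mathbb R\times\mathbb S^2$ in $\mathbb R\times\mathbb R\times\mathbb S^2$ with $V\subset (U\times\mathbb S^2)\cup\{\lambda\le 0\}$, a Lorentzian metric $g_{\mathrm{ext}}$ of class $C^k$ on $V$, and a time orientation of $(V,g_{\mathrm{ext}})$ given by a continuous timelike vector field, such that on $V\cap (U\times\mathbb S^2)$, identified through the coordinates with a subset of $M$, the metric $g_{\mathrm{ext}}$ equals $g$ and the time orientation agrees with that of $M$. -/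

import Mathlib

open scoped Manifold ContDiff Bundle

noncomputable section

namespace FlatFLRW

/-! ### Lorentzian metrics and time orientations on open subsets of manifolds -/

section Lorentz

/-- A bilinear form of signature `(-, +, …, +)`: it is symmetric and there is a timelike vector
whose orthogonal complement is positive definite. -/
def IsLorentzForm {T : Type*} [AddCommGroup T] [Module ℝ T] [TopologicalSpace T]
    [ContinuousAdd T] [ContinuousConstSMul ℝ T]
    (b : T →L[ℝ] T →L[ℝ] ℝ) : Prop :=
  (∀ u w, b u w = b w u) ∧
    ∃ u, b u u < 0 ∧ ∀ w, w ≠ 0 → b u w = 0 → 0 < b w w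

variable {E : Type*} [NormedAddCommGroup E] [NormedSpace ℝ E]
  {H : Type*} [TopologicalSpace H] (I : ModelWithCorners ℝ E H)
  {X : Type*} [TopologicalSpace X] [ChartedSpace H X] [IsManifold I 1 X]

/-- `g` is a Lorentzian metric tensor of class `C^k` on the subset `W` of the manifold `X`
(its values outside `W` are irrelevant). -/
structure IsLorentzMetricOn (k : WithTop ℕ∞) (W : Set X)
    (g : ∀ x : X, TangentSpace I x →L[ℝ] TangentSpace I x →L[ℝ] ℝ) : Prop where
  contMDiffOn : ContMDiffOn I (I.prod 𝓘(ℝ, E →L[ℝ] E →L[ℝ] ℝ)) k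
    (fun x ↦ Bundle.TotalSpace.mk' (E →L[ℝ] E →L[ℝ] ℝ)
      (E := fun x : X ↦ TangentSpace I x →L[ℝ] TangentSpace I x →L[ℝ] ℝ) x (g x)) W
  lorentz : ∀ x ∈ W, IsLorentzForm (g x)

/-- `Z` is a continuous `g`-timelike vector field on `W`; it induces a time orientation of
`(W, g)`, the one for which `Z` is future directed. -/
structure IsTimeOrientationOn (W : Set X)
    (g : ∀ x : X, TangentSpace I x →L[ℝ] TangentSpace I x →L[ℝ] ℝ)
    (Z : ∀ x : X, TangentSpace I x) : Prop where
  continuousOn : ContinuousOn (fun x ↦ (⟨x, Z x⟩ : TangentBundle I X)) W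
  timelike : ∀ x ∈ W, g x (Z x) (Z x) < 0

end Lorentz

/-! ### The flat FLRW spacetime -/

/-- Euclidean three-space. -/
abbrev Space : Type := EuclideanSpace ℝ (Fin 3)

/-- The unit two-sphere. -/
abbrev Sphere2 : Type := Metric.sphere (0 : Space) 1

/-- The model with corners of the manifold `ℝ × ℝ³`. -/
abbrev modelTX : ModelWithCorners ℝ (ℝ × Space) (ℝ × Space) := 𝓘(ℝ, ℝ × Space)

/-- The model with corners of the manifold `ℝ × ℝ × 𝕊²`. -/
abbrev modelLV : ModelWithCorners ℝ (ℝ × ℝ × EuclideanSpace ℝ (Fin 2))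
    (ModelProd ℝ (ModelProd ℝ (EuclideanSpace ℝ (Fin 2)))) :=
  𝓘(ℝ, ℝ).prod (𝓘(ℝ, ℝ).prod (𝓡 2))

/-- The manifold `M = (-∞, tmax) × ℝ³`, with points `(t, x)`. -/
def spacetime (tmax : ℝ) : Set (ℝ × Space) := {q | q.1 < tmax}

/-- The metric `-dt² + a(t)² (dx² + dy² + dz²)`. -/
def metric (a : ℝ → ℝ) (q : ℝ × Space) :
    TangentSpace modelTX q →L[ℝ] TangentSpace modelTX q →L[ℝ] ℝ :=
  let dt : (ℝ × Space) →L[ℝ] ℝ := ContinuousLinearMap.fst ℝ ℝ Space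
  let dx : (ℝ × Space) →L[ℝ] Space := ContinuousLinearMap.snd ℝ ℝ Space
  let euclid : Space →L[ℝ] Space →L[ℝ] ℝ := innerSL ℝ
  (-(ContinuousLinearMap.mul ℝ ℝ).bilinearComp dt dt
    + (a q.1) ^ 2 • euclid.bilinearComp dx dx : (ℝ × Space) →L[ℝ] (ℝ × Space) →L[ℝ] ℝ)

theorem metric_apply (a : ℝ → ℝ) (q : ℝ × Space) (u w : TangentSpace modelTX q) :
    metric a q u w = -((u : ℝ × Space).1 * (w : ℝ × Space).1)
      + (a q.1) ^ 2 * inner ℝ (u : ℝ × Space).2 (w : ℝ × Space).2 := rfl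

/-- The vector field `∂_t`, which is declared to be future directed. -/
def partialT (q : ℝ × Space) : TangentSpace modelTX q := ((1, 0) : ℝ × Space)

/-- The Hubble parameter `H = ȧ / a`. -/
def hubble (a : ℝ → ℝ) (t : ℝ) : ℝ := deriv a t / a t

/-- The coordinate `λ(t) = ∫_{-∞}^t a(s) ds`. -/
def lam (a : ℝ → ℝ) (t : ℝ) : ℝ := ∫ s in Set.Iic t, a s

/-- Conformal time `η(t) = -∫_t^{tL} ds / a(s)`. -/
def eta (a : ℝ → ℝ) (tL t : ℝ) : ℝ := -∫ s in t..tL, (a s)⁻¹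

/-- The direction `x / ‖x‖ ∈ 𝕊²` of `x ≠ 0` (an arbitrary point of the sphere if `x = 0`). -/
def direction (x : Space) : Sphere2 :=
  if hx : x = 0 then ⟨EuclideanSpace.single 0 1, by simp⟩
  else ⟨‖x‖⁻¹ • x, by simp [norm_smul, hx]⟩

/-- The change of coordinates `(t, x) ↦ (λ, v, n)`, where `λ = λ(t)`, `v = η(t) + r`, `r = ‖x‖`
and `n = x / ‖x‖`. It is only used where `x ≠ 0`. -/
def coords (a : ℝ → ℝ) (tL : ℝ) (q : ℝ × Space) : ℝ × ℝ × Sphere2 :=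
  (lam a q.1, eta a tL q.1 + ‖q.2‖, direction q.2)

/-- The image `U × 𝕊²` of the coordinates `(λ, v, n)`, i.e. of the part `r > 0` of `M`. -/
def coordImage (tmax tL : ℝ) (a : ℝ → ℝ) : Set (ℝ × ℝ × Sphere2) :=
  coords a tL '' {q | q ∈ spacetime tmax ∧ q.2 ≠ 0}

/-- `(M, g)` admits a `C^k` extension through the hypersurface `{λ = 0} = {0} × ℝ × 𝕊²`: in the
manifold `M ∪ ({λ ≤ 0} × 𝕊²)` there is a (connected) open neighbourhood `V` of this hypersurface
with a Lorentzian metric `gext` of class `C^k` and a time orientation, which agree on `M ∩ V` with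
the metric and the time orientation of `M`. The agreement is expressed by pulling back along
the coordinate map `(t, x) ↦ (λ, v, n)`. -/
def AdmitsExtensionThroughLamZero (k : WithTop ℕ∞) (tmax tL : ℝ) (a : ℝ → ℝ) : Prop :=
  ∃ (V : Set (ℝ × ℝ × Sphere2))
    (gext : ∀ p : ℝ × ℝ × Sphere2,
      TangentSpace modelLV p →L[ℝ] TangentSpace modelLV p →L[ℝ] ℝ)
    (Z : ∀ p : ℝ × ℝ × Sphere2, TangentSpace modelLV p),
    IsOpen V ∧ IsConnected V ∧
    (∀ (v : ℝ) (n : Sphere2), ((0, v, n) : ℝ × ℝ × Sphere2) ∈ V) ∧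
    (V ⊆ coordImage tmax tL a ∪ {p | p.1 ≤ 0}) ∧
    IsLorentzMetricOn modelLV k V gext ∧
    IsTimeOrientationOn modelLV V gext Z ∧
    ∀ q ∈ spacetime tmax, q.2 ≠ 0 → coords a tL q ∈ V →
      (∀ u w : TangentSpace modelTX q,
        gext (coords a tL q) (mfderiv modelTX modelLV (coords a tL) q u)
          (mfderiv modelTX modelLV (coords a tL) q w) = metric a q u w) ∧
      gext (coords a tL q) (Z (coords a tL q))
        (mfderiv modelTX modelLV (coords a tL) q (partialT q)) < 0

end FlatFLRW

end

/-! Since `dλ = a dt` and `dv = dt/a + dr`, the metric in the coordinates `(λ, v, ω)` is `-2 dλ dv +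
a² dv² + (a v - a η)² g_{𝕊²}`, because `a r = a v - a η`. This form is Lorentzian wherever `a v - a
η ≠ 0`, even where `a = 0`. Only `A = a` and `F = a η`, viewed as functions of `λ`, have to be
extended across `λ = 0`, with `A 0 = 0` and `F 0 < 0`; this is `admitsExtension_of_contDiffOn`.

With `d/dλ = a⁻¹ d/dt` one finds `A' = H`, `F' = H η + 1/a`, `A'' = Ḣ/a` and `F'' = Ḣ η / a`. If
these have limits at `λ = 0`, gluing to the Taylor polynomial on `λ ≤ 0` gives the required
regularity (`contDiffOn_one_glue`, `contDiffOn_two_glue`).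

The delicate limit is that of `F'`, where two divergent terms cancel. The error `o(e^{(2+ε)ht})`
makes `1/a - e^{-ht}` integrable at `-∞`, so `η + e^{-ht}/h` tends to some `c`
(`exists_tendsto_eta_add`). Hence `a η → -1/h` and `F' → h c` (`tendsto_hubble_mul_eta_add_inv`).
For the second derivatives, `Ḣ/a² → l` gives `A'' = (Ḣ/a²) a → 0` and `F'' = (Ḣ/a²)(a η) → -l/h`. -/

namespace FlatFLRW

open Filter Topology Set Asymptotics

/-! ### Pull-backs of bilinear forms and maps into the sphere -/

section Pullback

variable {E : Type*} [NormedAddCommGroup E] [NormedSpace ℝ E]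
  {H : Type*} [TopologicalSpace H] {I : ModelWithCorners ℝ E H}
  {X : Type*} [TopologicalSpace X] [ChartedSpace H X] [IsManifold I 1 X]
  {F : Type*} [NormedAddCommGroup F] [NormedSpace ℝ F]

/-- The pull-back of a bilinear form `b` on the vector space `F` along the differential at `x` of a
map `φ` from a manifold to `F`. -/
noncomputable def pullbackForm (I : ModelWithCorners ℝ E H) (φ : X → F) (b : F →L[ℝ] F →L[ℝ] ℝ)
    (x : X) : TangentSpace I x →L[ℝ] TangentSpace I x →L[ℝ] ℝ :=
  let d : E →L[ℝ] F := mfderiv I 𝓘(ℝ, F) φ x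
  (b.bilinearComp d d : E →L[ℝ] E →L[ℝ] ℝ)

omit [IsManifold I 1 X] in
theorem pullbackForm_apply (φ : X → F) (b : F →L[ℝ] F →L[ℝ] ℝ) (x : X) (u w : TangentSpace I x) :
    pullbackForm I φ b x u w = b (mfderiv I 𝓘(ℝ, F) φ x u : F) (mfderiv I 𝓘(ℝ, F) φ x w : F) := rfl

/-- In the tangent trivialization at `x₀` the pulled-back form reads `b (D ·) (D ·)`, with `D` the
coordinate expression of the differential of `φ`. Differentiating costs one order, whence `k + 1 ≤
n`. -/
theorem contMDiffOn_pullbackForm {k n : WithTop ℕ∞} (hkn : k + 1 ≤ n) [IsManifold I n X]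
    {φ : X → F} (hφ : ContMDiff I 𝓘(ℝ, F) n φ)
    {W : Set X} {b : X → F →L[ℝ] F →L[ℝ] ℝ}
    (hb : ContMDiffOn I 𝓘(ℝ, F →L[ℝ] F →L[ℝ] ℝ) k b W) :
    ContMDiffOn I (I.prod 𝓘(ℝ, E →L[ℝ] E →L[ℝ] ℝ)) k
      (fun x ↦ Bundle.TotalSpace.mk' (E →L[ℝ] E →L[ℝ] ℝ)
        (E := fun x : X ↦ TangentSpace I x →L[ℝ] TangentSpace I x →L[ℝ] ℝ) x
          (pullbackForm I φ (b x) x)) W := by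
  intro x₀ hx₀
  rw [contMDiffWithinAt_hom_bundle]
  refine ⟨contMDiffWithinAt_id, ?_⟩
  have hd : ContMDiffAt I 𝓘(ℝ, E →L[ℝ] F) k
      (inTangentCoordinates I 𝓘(ℝ, F) id φ (mfderiv I 𝓘(ℝ, F) φ) x₀) x₀ :=
    ContMDiffAt.mfderiv_const (hφ x₀) hkn
  set D := inTangentCoordinates I 𝓘(ℝ, F) id φ (mfderiv I 𝓘(ℝ, F) φ) x₀ with hD
  have key : ContMDiffWithinAt I 𝓘(ℝ, E →L[ℝ] E →L[ℝ] ℝ) k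
      (fun x ↦ (b x).bilinearComp (D x) (D x)) W x₀ := by
    exact (hd.contMDiffWithinAt.clm_precomp (F₃ := ℝ)).clm_comp
      ((hb x₀ hx₀).clm_comp hd.contMDiffWithinAt)
  have hbase : ∀ x ∈ (trivializationAt E (TangentSpace I) x₀).baseSet,
      ContinuousLinearMap.inCoordinates E (TangentSpace I) (E →L[ℝ] ℝ)
        (fun x ↦ TangentSpace I x →L[ℝ] ℝ) x₀ x x₀ x (pullbackForm I φ (b x) x)
        = (b x).bilinearComp (D x) (D x) := by
    intro x hx
    ext u w
    have := inCoordinates_apply_eq₂ (E₃ := fun _ : X ↦ ℝ) (F₃ := ℝ)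
      (ϕ := pullbackForm I φ (b x) x) (v := u) (w := w) hx hx (by simp)
    refine this.trans ?_
    have hDx : ∀ u, D x u = mfderiv I 𝓘(ℝ, F) φ x
        ((trivializationAt E (TangentSpace I) x₀).symm x u) := by
      intro u
      simp only [hD, inTangentCoordinates, ContinuousLinearMap.inCoordinates]
      simp only [ContinuousLinearMap.coe_comp, Function.comp_apply]
      erw [Bundle.Trivialization.symmL_apply _ hx]
      exact DFunLike.congr_fun
        (TangentBundle.continuousLinearMapAt_model_space (𝕜 := ℝ) (φ x₀) (φ x)) _
    simp [hDx, pullbackForm_apply]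
  refine key.congr_of_eventuallyEq ?_ (hbase _ (by simp))
  filter_upwards [mem_nhdsWithin_of_mem_nhds
    ((trivializationAt E (TangentSpace I) x₀).open_baseSet.mem_nhds (by simp))] with x hx
  exact hbase x hx

end Pullback

section Sphere

open Module Metric

variable {E : Type*} [NormedAddCommGroup E] [InnerProductSpace ℝ E]
  {m : WithTop ℕ∞} {F : Type*} [NormedAddCommGroup F] [NormedSpace ℝ F]
  {H : Type*} [TopologicalSpace H] {I : ModelWithCorners ℝ F H}
  {M : Type*} [TopologicalSpace M] [ChartedSpace H M]

/-- The chart of the sphere at `f x₀` is stereographic projection from the antipode `-f x₀`, which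
extends analytically to an ambient neighbourhood of `f x₀`. -/
theorem contMDiffAt_sphere_of_coe {n : ℕ} [Fact (finrank ℝ E = n + 1)] {f : M → sphere (0 : E) 1}
    {x₀ : M} (hf : ContMDiffAt I 𝓘(ℝ, E) m (fun x ↦ (f x : E)) x₀) :
    ContMDiffAt I (𝓡 n) m f x₀ := by
  rw [contMDiffAt_iff_target]
  refine ⟨Topology.IsInducing.subtypeVal.continuousAt_iff.2 hf.continuousAt, ?_⟩
  set v := f x₀
  let U : _ ≃ₗᵢ[ℝ] _ :=
    (OrthonormalBasis.fromOrthogonalSpanSingleton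
        n (ne_zero_of_mem_unit_sphere (-v))).repr
  have H₁ : ContDiffAt ℝ ω (U ∘ stereoToFun (-v : E)) (v : E) := by
    refine U.contDiff.contDiffAt.comp _ (contDiffOn_stereoToFun.contDiffAt ?_)
    refine (isOpen_ne_fun (by fun_prop) (by fun_prop)).mem_nhds ?_
    simp
    norm_num
  exact (H₁.of_le le_top).comp_contMDiffAt (f := fun x ↦ (f x : E)) hf

end Sphere

/-! ### The extended metric in the coordinates `(λ, v, n)` -/

theorem finrank_space : Fact (Module.finrank ℝ Space = 2 + 1) := ⟨finrank_euclideanSpace_fin⟩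

theorem contMDiff_coe_sphere2 {m : WithTop ℕ∞} :
    ContMDiff (𝓡 2) 𝓘(ℝ, Space) m ((↑) : Sphere2 → Space) :=
  haveI := finrank_space
  contMDiff_coe_sphere

theorem mfderiv_coe_sphere2_injective (n : Sphere2) :
    Function.Injective (mfderiv (𝓡 2) 𝓘(ℝ, Space) ((↑) : Sphere2 → Space) n) :=
  haveI := finrank_space
  injective_mvfderiv_subtypeVal_sphere n

/-- The inclusion `ℝ × ℝ × 𝕊² → ℝ × ℝ × ℝ³`. -/
def sphereInclusion (p : ℝ × ℝ × Sphere2) : ℝ × ℝ × Space := (p.1, p.2.1, (p.2.2 : Space))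

theorem contMDiff_sphereInclusion {n : WithTop ℕ∞} :
    ContMDiff modelLV 𝓘(ℝ, ℝ × ℝ × Space) n sphereInclusion :=
  contMDiff_fst.prodMk_space ((contMDiff_fst.comp contMDiff_snd).prodMk_space
    (contMDiff_coe_sphere2.comp (contMDiff_snd.comp contMDiff_snd)))

theorem _root_.HasMFDerivAt.prodMk_space {E H M E' E'' : Type*} [NormedAddCommGroup E]
    [NormedSpace ℝ E] [TopologicalSpace H] {I : ModelWithCorners ℝ E H} [TopologicalSpace M]
    [ChartedSpace H M] [NormedAddCommGroup E'] [NormedSpace ℝ E'] [NormedAddCommGroup E'']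
    [NormedSpace ℝ E''] {f : M → E'} {g : M → E''} {x : M} {df : TangentSpace I x →L[ℝ] E'}
    {dg : TangentSpace I x →L[ℝ] E''} (hf : HasMFDerivAt I 𝓘(ℝ, E') f x df)
    (hg : HasMFDerivAt I 𝓘(ℝ, E'') g x dg) :
    HasMFDerivAt I 𝓘(ℝ, E' × E'') (fun y ↦ (f y, g y)) x (df.prod dg) :=
  ⟨hf.1.prodMk hg.1, hf.2.prodMk hg.2⟩

theorem mfderiv_sphereInclusion (p : ℝ × ℝ × Sphere2) (w : TangentSpace modelLV p) :
    (mfderiv modelLV 𝓘(ℝ, ℝ × ℝ × Space) sphereInclusion p w : ℝ × ℝ × Space) =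
      ((w : ℝ × ℝ × EuclideanSpace ℝ (Fin 2)).1, (w : ℝ × ℝ × EuclideanSpace ℝ (Fin 2)).2.1,
        (mfderiv (𝓡 2) 𝓘(ℝ, Space) ((↑) : Sphere2 → Space) p.2.2
          (w : ℝ × ℝ × EuclideanSpace ℝ (Fin 2)).2.2 : Space)) := by
  have h1 : HasMFDerivAt modelLV 𝓘(ℝ, ℝ) (fun p : ℝ × ℝ × Sphere2 ↦ p.1) p
      (ContinuousLinearMap.fst ℝ ℝ (ℝ × EuclideanSpace ℝ (Fin 2))) := hasMFDerivAt_fst p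
  have hs : HasMFDerivAt modelLV (𝓘(ℝ, ℝ).prod (𝓡 2)) (fun p : ℝ × ℝ × Sphere2 ↦ p.2) p
      (ContinuousLinearMap.snd ℝ ℝ (ℝ × EuclideanSpace ℝ (Fin 2))) := hasMFDerivAt_snd p
  have h2 : HasMFDerivAt (𝓘(ℝ, ℝ).prod (𝓡 2)) 𝓘(ℝ, ℝ) (fun p : ℝ × Sphere2 ↦ p.1) p.2
      (ContinuousLinearMap.fst ℝ ℝ (EuclideanSpace ℝ (Fin 2))) := hasMFDerivAt_fst p.2
  have h3 : HasMFDerivAt (𝓘(ℝ, ℝ).prod (𝓡 2)) (𝓡 2) (fun p : ℝ × Sphere2 ↦ p.2) p.2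
      (ContinuousLinearMap.snd ℝ ℝ (EuclideanSpace ℝ (Fin 2))) := hasMFDerivAt_snd p.2
  have h4 : HasMFDerivAt (𝓡 2) 𝓘(ℝ, Space) ((↑) : Sphere2 → Space) p.2.2
      (mfderiv (𝓡 2) 𝓘(ℝ, Space) ((↑) : Sphere2 → Space) p.2.2) :=
    ((contMDiff_coe_sphere2 (m := 1) p.2.2).mdifferentiableAt one_ne_zero).hasMFDerivAt
  have := HasMFDerivAt.prodMk_space h1
    (HasMFDerivAt.prodMk_space (h2.comp p hs) (h4.comp p (h3.comp p hs)))
  rw [show mfderiv modelLV 𝓘(ℝ, ℝ × ℝ × Space) sphereInclusion p = _ from this.mfderiv]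
  rfl

theorem mfderiv_sphereInclusion_injective (p : ℝ × ℝ × Sphere2) (w : TangentSpace modelLV p)
    (hw : (mfderiv modelLV 𝓘(ℝ, ℝ × ℝ × Space) sphereInclusion p w : ℝ × ℝ × Space) = 0) :
    w = 0 := by
  rw [mfderiv_sphereInclusion] at hw
  have h1 := congrArg Prod.fst hw
  have h2 := congrArg (fun z ↦ z.2.1) hw
  have h3 := congrArg (fun z ↦ z.2.2) hw
  have h4 := mfderiv_coe_sphere2_injective p.2.2 (h3.trans (map_zero _).symm)
  exact Prod.ext h1 (Prod.ext h2 h4)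

/-- The bilinear form `-2 dλ dv + α dv² + β |dx|²` on `ℝ × ℝ × ℝ³`. -/
noncomputable def nullForm (α β : ℝ) : (ℝ × ℝ × Space) →L[ℝ] (ℝ × ℝ × Space) →L[ℝ] ℝ :=
  let dl : (ℝ × ℝ × Space) →L[ℝ] ℝ := ContinuousLinearMap.fst ℝ ℝ (ℝ × Space)
  let dv : (ℝ × ℝ × Space) →L[ℝ] ℝ :=
    (ContinuousLinearMap.fst ℝ ℝ Space).comp (ContinuousLinearMap.snd ℝ ℝ (ℝ × Space))
  let dx : (ℝ × ℝ × Space) →L[ℝ] Space :=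
    (ContinuousLinearMap.snd ℝ ℝ Space).comp (ContinuousLinearMap.snd ℝ ℝ (ℝ × Space))
  let euclid : Space →L[ℝ] Space →L[ℝ] ℝ := innerSL ℝ
  α • (ContinuousLinearMap.mul ℝ ℝ).bilinearComp dv dv + β • euclid.bilinearComp dx dx
    - ((ContinuousLinearMap.mul ℝ ℝ).bilinearComp dl dv
      + (ContinuousLinearMap.mul ℝ ℝ).bilinearComp dv dl)

theorem nullForm_apply (α β : ℝ) (u w : ℝ × ℝ × Space) :
    nullForm α β u w = α * (u.2.1 * w.2.1) + β * inner ℝ u.2.2 w.2.2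
      - (u.1 * w.2.1 + u.2.1 * w.1) := rfl

theorem contDiff_nullForm {k : WithTop ℕ∞} :
    ContDiff ℝ k (fun z : ℝ × ℝ ↦ nullForm z.1 z.2) := by
  -- The form is affine in its two coefficients; abstract constants suffice.
  have h {G : Type} [NormedAddCommGroup G] [NormedSpace ℝ G] (c₀ c₁ c₂ : G) :
      ContDiff ℝ k (fun z : ℝ × ℝ ↦ z.1 • c₁ + z.2 • c₂ - c₀) :=
    ((contDiff_fst.smul contDiff_const).add (contDiff_snd.smul contDiff_const)).sub contDiff_const
  exact h _ _ _

theorem nullForm_comm (α β : ℝ) (u w : ℝ × ℝ × Space) : nullForm α β u w = nullForm α β w u := by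
  rw [nullForm_apply, nullForm_apply, real_inner_comm]
  ring

/-- The metric `-2 dλ dv + A(λ)² dv² + (A(λ) v - F(λ))² g_{𝕊²}` on `ℝ × ℝ × 𝕊²`. -/
noncomputable def nullMetric (A F : ℝ → ℝ) (p : ℝ × ℝ × Sphere2) :
    TangentSpace modelLV p →L[ℝ] TangentSpace modelLV p →L[ℝ] ℝ :=
  pullbackForm modelLV sphereInclusion (nullForm (A p.1 ^ 2) ((A p.1 * p.2.1 - F p.1) ^ 2)) p

/-- The vector field `∂_λ + (1 + A(λ)²)⁻¹ ∂_v` on `ℝ × ℝ × 𝕊²`. -/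
noncomputable def nullTimeField (A : ℝ → ℝ) (p : ℝ × ℝ × Sphere2) : TangentSpace modelLV p :=
  ((1, (1 + A p.1 ^ 2)⁻¹, 0) : ℝ × ℝ × EuclideanSpace ℝ (Fin 2))

theorem mfderiv_sphereInclusion_nullTimeField (A : ℝ → ℝ) (p : ℝ × ℝ × Sphere2) :
    (mfderiv modelLV 𝓘(ℝ, ℝ × ℝ × Space) sphereInclusion p (nullTimeField A p) : ℝ × ℝ × Space) =
      (1, (1 + A p.1 ^ 2)⁻¹, 0) := by
  rw [mfderiv_sphereInclusion]
  refine Prod.ext rfl (Prod.ext rfl ?_)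
  exact map_zero (mfderiv (𝓡 2) 𝓘(ℝ, Space) ((↑) : Sphere2 → Space) p.2.2)

/-- With `s = (1 + a²)⁻¹` the value is `s (a² s - 2)`, and `a² s < 1`. -/
theorem nullForm_timeField_neg (a β : ℝ) :
    nullForm (a ^ 2) β (1, (1 + a ^ 2)⁻¹, 0) (1, (1 + a ^ 2)⁻¹, 0) < 0 := by
  rw [nullForm_apply]
  simp only [inner_self_eq_norm_sq_to_K, norm_zero]
  have h : 0 < 1 + a ^ 2 := by positivity
  have h1 : a ^ 2 * (1 + a ^ 2)⁻¹ < 1 := by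
    rw [← div_eq_mul_inv, div_lt_one h]; linarith
  have h2 : 0 < (1 + a ^ 2)⁻¹ := by positivity
  have h3 := mul_lt_mul_of_pos_right h1 h2
  simp
  nlinarith

/-- The weight `(1 + a²)⁻¹` is chosen so that the orthogonal complement is `p = -q` for every `a`;
there the form is `(a² + 2) q² + β ‖y‖²`. -/
theorem nullForm_timeField_orthogonal {a β : ℝ} (hβ : 0 < β) {w : ℝ × ℝ × Space} (hw : w ≠ 0)
    (hort : nullForm (a ^ 2) β (1, (1 + a ^ 2)⁻¹, 0) w = 0) : 0 < nullForm (a ^ 2) β w w := by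
  obtain ⟨p, q, y⟩ := w
  have h : 0 < 1 + a ^ 2 := by positivity
  have hpq : p = -q := by
    rw [nullForm_apply] at hort
    simp only [inner_zero_left] at hort
    field_simp at hort
    linarith
  rw [nullForm_apply]
  simp only [hpq, real_inner_self_eq_norm_sq]
  by_cases hq : q = 0
  · have hy : y ≠ 0 := by
      rintro rfl
      exact hw (by simp [hpq, hq])
    have : 0 < ‖y‖ := norm_pos_iff.2 hy
    simp only [hq]
    ring_nf
    positivity
  · have : 0 < q ^ 2 := by positivity
    have h1 : 0 ≤ a ^ 2 * (q * q) := by nlinarith [sq_nonneg (a * q)]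
    have h2 : 0 ≤ β * ‖y‖ ^ 2 := by positivity
    nlinarith

theorem isLorentzForm_nullMetric (A F : ℝ → ℝ) (p : ℝ × ℝ × Sphere2)
    (hp : A p.1 * p.2.1 - F p.1 ≠ 0) : IsLorentzForm (nullMetric A F p) := by
  refine ⟨fun u w ↦ ?_, nullTimeField A p, ?_, fun w hw hort ↦ ?_⟩
  · exact nullForm_comm _ _ _ _
  · rw [nullMetric, pullbackForm_apply, mfderiv_sphereInclusion_nullTimeField]
    exact nullForm_timeField_neg _ _
  · rw [nullMetric, pullbackForm_apply, mfderiv_sphereInclusion_nullTimeField] at hort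
    rw [nullMetric, pullbackForm_apply]
    exact nullForm_timeField_orthogonal (by positivity)
      (fun h ↦ hw (mfderiv_sphereInclusion_injective p w h)) hort

/-! ### Regularity of the extended metric and of its time orientation. -/

theorem contMDiffOn_nullForm {k : WithTop ℕ∞} {A F : ℝ → ℝ} {b : ℝ}
    (hA : ContDiffOn ℝ k A (Iio b)) (hF : ContDiffOn ℝ k F (Iio b)) {V : Set (ℝ × ℝ × Sphere2)}
    (hVb : ∀ p ∈ V, p.1 < b) :
    ContMDiffOn modelLV 𝓘(ℝ, (ℝ × ℝ × Space) →L[ℝ] (ℝ × ℝ × Space) →L[ℝ] ℝ) k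
      (fun p : ℝ × ℝ × Sphere2 ↦ nullForm (A p.1 ^ 2) ((A p.1 * p.2.1 - F p.1) ^ 2)) V := by
  have h1 : ContMDiffOn modelLV 𝓘(ℝ, ℝ × ℝ) k (fun p : ℝ × ℝ × Sphere2 ↦ (p.1, p.2.1)) V :=
    (contMDiff_fst.prodMk_space (contMDiff_fst.comp contMDiff_snd)).contMDiffOn
  have h2 : ContDiffOn ℝ k (fun z : ℝ × ℝ ↦ (A z.1 ^ 2, (A z.1 * z.2 - F z.1) ^ 2))
      (Prod.fst ⁻¹' Iio b) := by
    have hA' : ContDiffOn ℝ k (fun z : ℝ × ℝ ↦ A z.1) (Prod.fst ⁻¹' Iio b) :=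
      hA.comp contDiff_fst.contDiffOn fun _ h ↦ h
    have hF' : ContDiffOn ℝ k (fun z : ℝ × ℝ ↦ F z.1) (Prod.fst ⁻¹' Iio b) :=
      hF.comp contDiff_fst.contDiffOn fun _ h ↦ h
    exact (hA'.pow 2).prodMk (((hA'.mul contDiff_snd.contDiffOn).sub hF').pow 2)
  have h3 : ContMDiff 𝓘(ℝ, ℝ × ℝ) 𝓘(ℝ, (ℝ × ℝ × Space) →L[ℝ] (ℝ × ℝ × Space) →L[ℝ] ℝ) k
      (fun z : ℝ × ℝ ↦ nullForm z.1 z.2) := contDiff_nullForm.contMDiff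
  have h4 : ContMDiffOn modelLV 𝓘(ℝ, ℝ × ℝ) k
      (fun p : ℝ × ℝ × Sphere2 ↦ (A p.1 ^ 2, (A p.1 * p.2.1 - F p.1) ^ 2)) V :=
    h2.contMDiffOn.comp h1 hVb
  generalize nullForm = f at h3 ⊢
  exact h3.comp_contMDiffOn h4

theorem isLorentzMetricOn_nullMetric {k : WithTop ℕ∞} {A F : ℝ → ℝ} {b : ℝ}
    (hA : ContDiffOn ℝ k A (Iio b)) (hF : ContDiffOn ℝ k F (Iio b)) {V : Set (ℝ × ℝ × Sphere2)}
    (hVb : ∀ p ∈ V, p.1 < b) (hV : ∀ p ∈ V, A p.1 * p.2.1 - F p.1 ≠ 0) :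
    IsLorentzMetricOn modelLV k V (nullMetric A F) where
  contMDiffOn := contMDiffOn_pullbackForm (n := k + 1) le_rfl contMDiff_sphereInclusion
    (contMDiffOn_nullForm hA hF hVb)
  lorentz p hp := isLorentzForm_nullMetric A F p (hV p hp)

/-- The tangent bundle of a product is the product of the tangent bundles, so continuity is checked
by components; the sphere component is the zero section. -/
theorem continuousOn_nullTimeField {A : ℝ → ℝ} {V : Set (ℝ × ℝ × Sphere2)}
    (hA : ContinuousOn (fun p : ℝ × ℝ × Sphere2 ↦ A p.1) V) :
    ContinuousOn (fun p ↦ (⟨p, nullTimeField A p⟩ : TangentBundle modelLV (ℝ × ℝ × Sphere2))) V := by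
  have hR {f g : ℝ × ℝ × Sphere2 → ℝ} (hf : ContinuousOn f V) (hg : ContinuousOn g V) :
      ContinuousOn (fun p ↦ (⟨f p, g p⟩ : TangentBundle 𝓘(ℝ, ℝ) ℝ)) V :=
    (tangentBundleModelSpaceHomeomorph 𝓘(ℝ, ℝ)).symm.continuous.comp_continuousOn (hf.prodMk hg)
  have hS : Continuous (fun n ↦ (⟨n, 0⟩ : TangentBundle (𝓡 2) Sphere2)) :=
    (Bundle.contMDiff_zeroSection (n := 0) (IB := 𝓡 2) ℝ
      (TangentSpace (𝓡 2) (M := Sphere2))).continuous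
  have h1 := (hR (f := fun p ↦ p.2.1) (g := fun p ↦ (1 + A p.1 ^ 2)⁻¹) (by fun_prop)
    ((continuousOn_const.add (hA.pow 2)).inv₀ (fun p _ ↦ (by positivity : 1 + A p.1 ^ 2 ≠ 0)))).prodMk
    (hS.comp_continuousOn (f := fun p : ℝ × ℝ × Sphere2 ↦ p.2.2) (s := V) (by fun_prop))
  have h2 := (contMDiff_equivTangentBundleProd_symm (n := 0) (I := 𝓘(ℝ, ℝ)) (M := ℝ) (I' := 𝓡 2)
    (M' := Sphere2)).continuous.comp_continuousOn h1
  have h3 := (hR (f := fun p ↦ p.1) (g := fun _ ↦ 1) (by fun_prop) (by fun_prop)).prodMk h2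
  exact (contMDiff_equivTangentBundleProd_symm (n := 0) (I := 𝓘(ℝ, ℝ)) (M := ℝ)
    (I' := 𝓘(ℝ, ℝ).prod (𝓡 2)) (M' := ℝ × Sphere2)).continuous.comp_continuousOn h3

theorem isTimeOrientationOn_nullTimeField {A : ℝ → ℝ} (F : ℝ → ℝ) {V : Set (ℝ × ℝ × Sphere2)}
    (hA : ContinuousOn (fun p : ℝ × ℝ × Sphere2 ↦ A p.1) V) :
    IsTimeOrientationOn modelLV V (nullMetric A F) (nullTimeField A) := by
  refine ⟨continuousOn_nullTimeField hA, fun p _ ↦ ?_⟩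
  rw [nullMetric, pullbackForm_apply, mfderiv_sphereInclusion_nullTimeField]
  exact nullForm_timeField_neg _ _

/-! ### The coordinate map pulls the metric back to the flat FLRW metric -/

theorem coe_direction {x : Space} (hx : x ≠ 0) : (direction x : Space) = ‖x‖⁻¹ • x := by
  simp [direction, hx]

theorem direction_smul {r : ℝ} (hr : 0 < r) (n : Sphere2) : direction (r • (n : Space)) = n := by
  have hn : ‖(n : Space)‖ = 1 := by simp
  have h0 : r • (n : Space) ≠ 0 := by
    rw [← norm_ne_zero_iff, norm_smul, hn]
    simpa using hr.ne'
  ext1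
  rw [coe_direction h0, norm_smul, hn, smul_smul, Real.norm_of_nonneg hr.le, mul_one,
    inv_mul_cancel₀ hr.ne', one_smul]

theorem eventuallyEq_direction {x : Space} (hx : x ≠ 0) :
    (fun y ↦ (direction y : Space)) =ᶠ[𝓝 x] fun y ↦ ‖y‖⁻¹ • y := by
  filter_upwards [isOpen_ne.mem_nhds hx] with y hy using coe_direction hy

/-- Comparing the two expressions for the derivative of `‖y‖²` determines that of the norm. -/
theorem hasFDerivAt_norm {x : Space} (hx : x ≠ 0) :
    HasFDerivAt (fun y : Space ↦ ‖y‖) (‖x‖⁻¹ • innerSL ℝ x) x := by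
  have h : DifferentiableAt ℝ (fun y : Space ↦ ‖y‖) x := (differentiableAt_id).norm ℝ hx
  have h1 := h.hasFDerivAt.pow 2
  have h2 := h1.unique (hasStrictFDerivAt_norm_sq x).hasFDerivAt
  have hx' : ‖x‖ ≠ 0 := norm_ne_zero_iff.2 hx
  refine h.hasFDerivAt.congr_fderiv ?_
  ext u
  have h3 := DFunLike.congr_fun h2 u
  simp at h3
  simp only [smul_apply, innerSL_apply_apply, smul_eq_mul]
  field_simp
  linarith

theorem hasFDerivAt_coe_direction {x : Space} (hx : x ≠ 0) :
    HasFDerivAt (fun y ↦ (direction y : Space))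
      (‖x‖⁻¹ • ContinuousLinearMap.id ℝ Space
        - ((‖x‖⁻¹ ^ 3) • innerSL ℝ x).smulRight x) x := by
  have hx' : ‖x‖ ≠ 0 := norm_ne_zero_iff.2 hx
  have h1 := ((hasDerivAt_inv hx').comp_hasFDerivAt x (hasFDerivAt_norm hx)).smul (hasFDerivAt_id x)
  refine (h1.congr_of_eventuallyEq (eventuallyEq_direction hx)).congr_fderiv ?_
  ext u
  simp
  field_simp
  ring

theorem mdifferentiableAt_direction {x : Space} (hx : x ≠ 0) :
    MDifferentiableAt 𝓘(ℝ, Space) (𝓡 2) direction x := by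
  have := finrank_space
  have h : ContDiffAt ℝ 1 (fun y : Space ↦ ‖y‖⁻¹ • y) x :=
    ((contDiffAt_norm ℝ hx).inv (norm_ne_zero_iff.2 hx)).smul contDiffAt_id
  exact (contMDiffAt_sphere_of_coe (n := 2) (f := direction)
    (h.congr_of_eventuallyEq (eventuallyEq_direction hx)).contMDiffAt).mdifferentiableAt one_ne_zero

variable {a : ℝ → ℝ} {tL : ℝ} {q : ℝ × Space}

theorem mdifferentiableAt_coords (hl : DifferentiableAt ℝ (lam a) q.1)
    (he : DifferentiableAt ℝ (eta a tL) q.1) (hq : q.2 ≠ 0) :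
    MDifferentiableAt modelTX modelLV (coords a tL) q := by
  have h1 : DifferentiableAt ℝ (fun q : ℝ × Space ↦ lam a q.1) q := hl.comp q differentiableAt_fst
  have h2 : DifferentiableAt ℝ (fun q : ℝ × Space ↦ eta a tL q.1 + ‖q.2‖) q :=
    (he.comp q differentiableAt_fst).add (differentiableAt_snd.norm ℝ hq)
  have h3 : MDifferentiableAt modelTX 𝓘(ℝ, Space) (fun q : ℝ × Space ↦ q.2) q :=
    differentiableAt_snd.mdifferentiableAt
  exact h1.mdifferentiableAt.prodMk
    (h2.mdifferentiableAt.prodMk ((mdifferentiableAt_direction hq).comp q h3))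

/-- After composition with the inclusion of the sphere, the coordinate map takes values in a vector
space, so its differential is an ordinary Fréchet derivative and no sphere chart enters. -/
theorem mfderiv_sphereInclusion_mfderiv_coords {l e : ℝ} (hl : HasDerivAt (lam a) l q.1)
    (he : HasDerivAt (eta a tL) e q.1) (hq : q.2 ≠ 0) (u : TangentSpace modelTX q) :
    (mfderiv modelLV 𝓘(ℝ, ℝ × ℝ × Space) sphereInclusion (coords a tL q)
      (mfderiv modelTX modelLV (coords a tL) q u) : ℝ × ℝ × Space) =
    (l * (u : ℝ × Space).1,
      e * (u : ℝ × Space).1 + ‖q.2‖⁻¹ * inner ℝ q.2 (u : ℝ × Space).2,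
      ‖q.2‖⁻¹ • (u : ℝ × Space).2
        - (‖q.2‖⁻¹ ^ 3 * inner ℝ q.2 (u : ℝ × Space).2) • q.2) := by
  have hc := mdifferentiableAt_coords hl.differentiableAt he.differentiableAt hq
  have hi : MDifferentiableAt modelLV 𝓘(ℝ, ℝ × ℝ × Space) sphereInclusion (coords a tL q) :=
    (contMDiff_sphereInclusion (n := 1) _).mdifferentiableAt one_ne_zero
  have hfst : HasFDerivAt Prod.fst (ContinuousLinearMap.fst ℝ ℝ Space) q := hasFDerivAt_fst
  have hsnd : HasFDerivAt Prod.snd (ContinuousLinearMap.snd ℝ ℝ Space) q := hasFDerivAt_snd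
  have h1 : HasFDerivAt (fun q : ℝ × Space ↦ lam a q.1) _ q := hl.comp_hasFDerivAt q hfst
  have h2 : HasFDerivAt (fun q : ℝ × Space ↦ eta a tL q.1 + ‖q.2‖) _ q :=
    (he.comp_hasFDerivAt q hfst).add ((hasFDerivAt_norm hq).comp q hsnd)
  have h3 : HasFDerivAt (fun q : ℝ × Space ↦ (direction q.2 : Space)) _ q :=
    (hasFDerivAt_coe_direction hq).comp q hsnd
  have h := (h1.prodMk (h2.prodMk h3)).hasMFDerivAt.mfderiv
  have h' := mfderiv_comp q hi hc
  have h4 := DFunLike.congr_fun (h'.symm.trans h) u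
  exact h4

/-- The radial part is `a² dv² - 2 a dt dv = -dt² + a² dr²`, by `dv = dt/a + dr`. The angular part
is `a² r² |dω|² = a² (|dx|² - dr²)`, since `A v - F = a r`. -/
theorem nullMetric_pullback {A F : ℝ → ℝ} (ha : a q.1 ≠ 0) (hl : HasDerivAt (lam a) (a q.1) q.1)
    (he : HasDerivAt (eta a tL) (a q.1)⁻¹ q.1) (hq : q.2 ≠ 0)
    (hA : A (lam a q.1) = a q.1) (hF : F (lam a q.1) = a q.1 * eta a tL q.1)
    (u w : TangentSpace modelTX q) :
    nullMetric A F (coords a tL q) (mfderiv modelTX modelLV (coords a tL) q u)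
      (mfderiv modelTX modelLV (coords a tL) q w) = metric a q u w := by
  rw [nullMetric, pullbackForm_apply, mfderiv_sphereInclusion_mfderiv_coords hl he hq,
    mfderiv_sphereInclusion_mfderiv_coords hl he hq, nullForm_apply, metric_apply]
  obtain ⟨t, x⟩ := q
  obtain ⟨ut, ux⟩ := u
  obtain ⟨wt, wx⟩ := w
  have hx' : ‖x‖ ≠ 0 := norm_ne_zero_iff.2 hq
  simp only [coords, hA, hF, inner_sub_left, inner_sub_right, real_inner_smul_left,
    real_inner_smul_right, real_inner_self_eq_norm_sq, real_inner_comm x]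
  field_simp
  ring

/-- The contributions of the `∂_v` component cancel, leaving exactly `-1/a`. -/
theorem nullMetric_timeField_partialT_neg {A : ℝ → ℝ} (F : ℝ → ℝ) (ha : 0 < a q.1)
    (hl : HasDerivAt (lam a) (a q.1) q.1)
    (he : HasDerivAt (eta a tL) (a q.1)⁻¹ q.1) (hq : q.2 ≠ 0) (hA : A (lam a q.1) = a q.1) :
    nullMetric A F (coords a tL q) (nullTimeField A (coords a tL q))
      (mfderiv modelTX modelLV (coords a tL) q (partialT q)) < 0 := by
  rw [nullMetric, pullbackForm_apply, mfderiv_sphereInclusion_mfderiv_coords hl he hq,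
    mfderiv_sphereInclusion_nullTimeField, nullForm_apply]
  simp only [coords, hA, partialT, inner_zero_left, inner_zero_right]
  have : 0 < (a q.1)⁻¹ := by positivity
  have hr : 0 < ‖q.2‖ := norm_pos_iff.2 hq
  field_simp
  nlinarith [mul_nonneg (sq_nonneg (a q.1)) hr.le]

/-! ### Extension criterion -/

theorem isOpen_nullDomain {A F : ℝ → ℝ} {b : ℝ} (hA : ContinuousOn A (Iio b))
    (hF : ContinuousOn F (Iio b)) :
    IsOpen {p : ℝ × ℝ × Sphere2 | p.1 < b ∧ 0 < A p.1 * p.2.1 - F p.1} := by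
  have ho : IsOpen {p : ℝ × ℝ × Sphere2 | p.1 < b} := isOpen_lt continuous_fst continuous_const
  have hA' : ContinuousOn (fun p : ℝ × ℝ × Sphere2 ↦ A p.1) {p | p.1 < b} :=
    hA.comp continuousOn_fst fun _ h ↦ h
  have hF' : ContinuousOn (fun p : ℝ × ℝ × Sphere2 ↦ F p.1) {p | p.1 < b} :=
    hF.comp continuousOn_fst fun _ h ↦ h
  exact ContinuousOn.isOpen_inter_preimage (t := Ioi 0)
    (f := fun p : ℝ × ℝ × Sphere2 ↦ A p.1 * p.2.1 - F p.1)
    ((hA'.mul (by fun_prop)).sub hF') ho isOpen_Ioi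

theorem isPreconnected_lamZero : IsPreconnected {p : ℝ × ℝ × Sphere2 | p.1 = 0} := by
  have h : IsPreconnected (univ : Set Sphere2) :=
    have := isPreconnected_iff_preconnectedSpace.1
      (isPreconnected_sphere (E := Space) (by simp [← Module.finrank_eq_rank]) 0 1)
    isPreconnected_univ
  have h1 : {p : ℝ × ℝ × Sphere2 | p.1 = 0} = {0} ×ˢ univ ×ˢ univ := by ext; simp
  rw [h1]
  exact isPreconnected_singleton.prod (isPreconnected_univ.prod h)

/-- If `a` and `a η`, as functions of `λ`, extend to functions of class `C^k` across `λ = 0`, with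
the extension of `a η` negative and that of `a` zero at `λ = 0`, then the spacetime extends. -/
theorem admitsExtension_of_contDiffOn {k : WithTop ℕ∞} {tmax t₁ : ℝ} (ht₁ : t₁ < tmax)
    (ha : ∀ t < tmax, 0 < a t)
    (hl : ∀ t < tmax, HasDerivAt (lam a) (a t) t)
    (he : ∀ t < tmax, HasDerivAt (eta a tL) (a t)⁻¹ t)
    (hlam : ∀ s t, s < t → t < tmax → lam a s < lam a t)
    (hpos : 0 < lam a t₁)
    (hsurj : ∀ x, 0 < x → x < lam a t₁ → ∃ t < t₁, lam a t = x)
    {A F : ℝ → ℝ} (hA : ContDiffOn ℝ k A (Iio (lam a t₁)))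
    (hF : ContDiffOn ℝ k F (Iio (lam a t₁)))
    (hA₀ : A 0 = 0) (hF₀ : F 0 < 0)
    (hAa : ∀ t < t₁, A (lam a t) = a t) (hFa : ∀ t < t₁, F (lam a t) = a t * eta a tL t) :
    AdmitsExtensionThroughLamZero k tmax tL a := by
  -- For `0 < λ < λ(t₁)` the second condition says `a r > 0`; at `λ = 0` it reads `-F 0 > 0`, so it
  -- holds for every `v`.
  set W : Set (ℝ × ℝ × Sphere2) := {p | p.1 < lam a t₁ ∧ 0 < A p.1 * p.2.1 - F p.1} with hW
  have hWo : IsOpen W := isOpen_nullDomain hA.continuousOn hF.continuousOn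
  have hzero : {p : ℝ × ℝ × Sphere2 | p.1 = 0} ⊆ W := by
    rintro ⟨x, v, n⟩ rfl
    simp [hW, hA₀, hF₀, hpos]
  let p₀ : ℝ × ℝ × Sphere2 := (0, 0, direction 0)
  have hp₀ : p₀ ∈ W := hzero rfl
  -- Passing to a component secures connectedness; it is open by local connectedness and contains
  -- the whole of `{λ = 0}`, which is connected.
  set V := connectedComponentIn W p₀ with hV
  have hVW : V ⊆ W := connectedComponentIn_subset W p₀
  have : LocallyConnectedSpace (ModelProd ℝ (ModelProd ℝ (EuclideanSpace ℝ (Fin 2)))) :=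
    inferInstanceAs (LocallyConnectedSpace (ℝ × ℝ × EuclideanSpace ℝ (Fin 2)))
  have : LocallyConnectedSpace (ℝ × ℝ × Sphere2) :=
    ChartedSpace.locallyConnectedSpace
      (ModelProd ℝ (ModelProd ℝ (EuclideanSpace ℝ (Fin 2)))) (ℝ × ℝ × Sphere2)
  have hAc : ContinuousOn (fun p : ℝ × ℝ × Sphere2 ↦ A p.1) V :=
    hA.continuousOn.comp continuousOn_fst fun p hp ↦ (hVW hp).1
  refine ⟨V, nullMetric A F, nullTimeField A, hWo.connectedComponentIn,
    isConnected_connectedComponentIn_iff.2 hp₀, fun v n ↦ ?_, ?_,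
    isLorentzMetricOn_nullMetric hA hF (fun p hp ↦ (hVW hp).1) (fun p hp ↦ (hVW hp).2.ne'),
    isTimeOrientationOn_nullTimeField F hAc, ?_⟩
  · exact isPreconnected_lamZero.subset_connectedComponentIn rfl hzero rfl
  · rintro ⟨x, v, n⟩ hp
    obtain ⟨hp1, hp2⟩ := hVW hp
    rcases le_or_gt x 0 with hx | hx
    · exact Or.inr hx
    · left
      obtain ⟨t, ht, rfl⟩ := hsurj x hx hp1
      simp only [hAa t ht, hFa t ht] at hp2
      have hr : 0 < v - eta a tL t := by
        have := ha t (ht.trans ht₁)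
        by_contra! h
        nlinarith
      have hn : ‖(n : Space)‖ = 1 := by simp
      refine ⟨(t, (v - eta a tL t) • (n : Space)), ⟨ht.trans ht₁, ?_⟩, ?_⟩
      · exact smul_ne_zero hr.ne' (norm_ne_zero_iff.1 (by rw [hn]; exact one_ne_zero))
      · simp only [coords, direction_smul hr, norm_smul, hn, Real.norm_of_nonneg hr.le]
        simp
  · intro q hq hq2 hqV
    have hqt : q.1 < t₁ := by
      by_contra! h
      have h1 : lam a q.1 < lam a t₁ := (hVW hqV).1
      rcases h.eq_or_lt with h | h
      · rw [h] at h1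
        exact h1.false
      · exact (h1.trans (hlam _ _ h hq)).false
    exact ⟨nullMetric_pullback (ha _ hq).ne' (hl _ hq) (he _ hq) hq2 (hAa _ hqt) (hFa _ hqt),
      nullMetric_timeField_partialT_neg F (ha _ hq) (hl _ hq) (he _ hq) hq2 (hAa _ hqt)⟩

/-! ### Gluing functions at zero -/

/-- The function which is `p` on `(-∞, 0]` and `f` on `(0, ∞)`. -/
noncomputable def glue (p f : ℝ → ℝ) (x : ℝ) : ℝ := if x ≤ 0 then p x else f x

theorem glue_of_nonpos {p f : ℝ → ℝ} {x : ℝ} (hx : x ≤ 0) : glue p f x = p x := if_pos hx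

theorem glue_of_pos {p f : ℝ → ℝ} {x : ℝ} (hx : 0 < x) : glue p f x = f x := if_neg hx.not_ge

theorem glue_eventuallyEq_left {p f : ℝ → ℝ} {x : ℝ} (hx : x < 0) : glue p f =ᶠ[𝓝 x] p := by
  filter_upwards [Iio_mem_nhds hx] with y hy using glue_of_nonpos (le_of_lt hy)

theorem glue_eventuallyEq_right {p f : ℝ → ℝ} {x : ℝ} (hx : 0 < x) : glue p f =ᶠ[𝓝 x] f := by
  filter_upwards [Ioi_mem_nhds hx] with y hy using glue_of_pos hy

theorem tendsto_glue_nhdsGT {p f : ℝ → ℝ} {l : ℝ} (hf : Tendsto f (𝓝[>] 0) (𝓝 l)) :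
    Tendsto (glue p f) (𝓝[>] 0) (𝓝 l) := by
  refine hf.congr' ?_
  filter_upwards [self_mem_nhdsWithin] with y hy using (glue_of_pos hy).symm

theorem continuousOn_glue {p f : ℝ → ℝ} {b : ℝ} (hp : Continuous p)
    (hf : ContinuousOn f (Ioo 0 b)) (hf₀ : Tendsto f (𝓝[>] 0) (𝓝 (p 0))) :
    ContinuousOn (glue p f) (Iio b) := by
  intro x hx
  refine ContinuousAt.continuousWithinAt ?_
  rcases lt_trichotomy x 0 with h | rfl | h
  · exact hp.continuousAt.congr (glue_eventuallyEq_left h).symm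
  · refine continuousAt_iff_continuous_left'_right'.2 ⟨?_, ?_⟩
    · refine hp.continuousWithinAt.congr (fun y hy ↦ glue_of_nonpos (le_of_lt hy))
        (glue_of_nonpos le_rfl)
    · unfold ContinuousWithinAt
      rw [glue_of_nonpos le_rfl]
      exact tendsto_glue_nhdsGT hf₀
  · exact (hf.continuousAt (Ioo_mem_nhds h hx)).congr (glue_eventuallyEq_right h).symm

/-- At `0` the left derivative is that of `p`; the right derivative exists because the glued
function is continuous and its derivative has a limit from the right. -/
theorem hasDerivAt_glue {p p' f f' : ℝ → ℝ} {b : ℝ} (hb : 0 < b)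
    (hp : ∀ x, HasDerivAt p (p' x) x) (hf : ∀ x ∈ Ioo 0 b, HasDerivAt f (f' x) x)
    (hf₀ : Tendsto f (𝓝[>] 0) (𝓝 (p 0))) (hf'₀ : Tendsto f' (𝓝[>] 0) (𝓝 (p' 0)))
    {x : ℝ} (hx : x < b) : HasDerivAt (glue p f) (glue p' f' x) x := by
  rcases lt_trichotomy x 0 with h | rfl | h
  · rw [glue_of_nonpos h.le]
    exact (hp x).congr_of_eventuallyEq (glue_eventuallyEq_left h)
  · rw [glue_of_nonpos le_rfl]
    have hI : Ioo 0 b ∈ 𝓝[>] (0 : ℝ) := Ioo_mem_nhdsGT hb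
    have hd : ∀ y ∈ Ioo 0 b, HasDerivAt (glue p f) (f' y) y := fun y hy ↦
      (hf y hy).congr_of_eventuallyEq (glue_eventuallyEq_right hy.1)
    have h1 : HasDerivWithinAt (glue p f) (p' 0) (Iic 0) 0 :=
      (hp 0).hasDerivWithinAt.congr (fun y hy ↦ glue_of_nonpos hy) (glue_of_nonpos le_rfl)
    have h2 : HasDerivWithinAt (glue p f) (p' 0) (Ici 0) 0 := by
      refine hasDerivWithinAt_Ici_of_tendsto_deriv (s := Ioo 0 b)
        (fun y hy ↦ (hd y hy).differentiableAt.differentiableWithinAt) ?_ hI ?_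
      · refine ((continuousOn_glue (b := b) (continuous_iff_continuousAt.2 fun x ↦
          (hp x).continuousAt) (fun y hy ↦ (hf y hy).continuousAt.continuousWithinAt) hf₀) 0
          hb).mono fun y hy ↦ hy.2
      · refine hf'₀.congr' ?_
        filter_upwards [hI] with y hy using (hd y hy).deriv.symm
    simpa using h1.union h2
  · rw [glue_of_pos h]
    exact (hf x ⟨h, hx⟩).congr_of_eventuallyEq (glue_eventuallyEq_right h)

theorem contDiffOn_one_glue {p p' f f' : ℝ → ℝ} {b : ℝ} (hb : 0 < b)
    (hp : ∀ x, HasDerivAt p (p' x) x) (hp' : Continuous p')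
    (hf : ∀ x ∈ Ioo 0 b, HasDerivAt f (f' x) x) (hf' : ContinuousOn f' (Ioo 0 b))
    (hf₀ : Tendsto f (𝓝[>] 0) (𝓝 (p 0))) (hf'₀ : Tendsto f' (𝓝[>] 0) (𝓝 (p' 0))) :
    ContDiffOn ℝ 1 (glue p f) (Iio b) := by
  have hd {x : ℝ} (hx : x < b) := hasDerivAt_glue hb hp hf hf₀ hf'₀ hx
  rw [show (1 : WithTop ℕ∞) = 0 + 1 by simp, contDiffOn_succ_iff_deriv_of_isOpen isOpen_Iio]
  refine ⟨fun x hx ↦ (hd hx).differentiableAt.differentiableWithinAt, by simp, ?_⟩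
  exact contDiffOn_zero.2
    ((continuousOn_glue hp' hf' hf'₀).congr fun x hx ↦ (hd hx).deriv)

theorem contDiffOn_two_glue {p p' p'' f f' f'' : ℝ → ℝ} {b : ℝ} (hb : 0 < b)
    (hp : ∀ x, HasDerivAt p (p' x) x) (hp' : ∀ x, HasDerivAt p' (p'' x) x) (hp'' : Continuous p'')
    (hf : ∀ x ∈ Ioo 0 b, HasDerivAt f (f' x) x) (hf' : ∀ x ∈ Ioo 0 b, HasDerivAt f' (f'' x) x)
    (hf'' : ContinuousOn f'' (Ioo 0 b))
    (hf₀ : Tendsto f (𝓝[>] 0) (𝓝 (p 0))) (hf'₀ : Tendsto f' (𝓝[>] 0) (𝓝 (p' 0)))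
    (hf''₀ : Tendsto f'' (𝓝[>] 0) (𝓝 (p'' 0))) :
    ContDiffOn ℝ 2 (glue p f) (Iio b) := by
  have hd {x : ℝ} (hx : x < b) := hasDerivAt_glue hb hp hf hf₀ hf'₀ hx
  rw [show (2 : WithTop ℕ∞) = 1 + 1 by norm_num, contDiffOn_succ_iff_deriv_of_isOpen isOpen_Iio]
  refine ⟨fun x hx ↦ (hd hx).differentiableAt.differentiableWithinAt, by simp, ?_⟩
  exact (contDiffOn_one_glue hb hp' hp'' hf' hf'' hf'₀ hf''₀).congr fun x hx ↦ (hd hx).deriv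

/-! ### The coordinate functions `λ` and `η` -/

section Coordinates

variable {a : ℝ → ℝ} {tmax : ℝ}

theorem integrableOn_Iic_of_isBigO_exp {f : ℝ → ℝ} {c t : ℝ} (hc : 0 < c)
    (hf : ContinuousOn f (Iio tmax)) (ht : t < tmax)
    (hO : f =O[atBot] fun s ↦ Real.exp (c * s)) : MeasureTheory.IntegrableOn f (Iic t) := by
  obtain ⟨C, hC⟩ := hO.bound
  obtain ⟨T, hT⟩ := eventually_atBot.1 hC
  -- Below `T'` the exponential bound applies; `[T', t]` is compact inside the domain of continuity.
  set T' := min T t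
  have hT' : T' < tmax := (min_le_right _ _).trans_lt ht
  have h1 : MeasureTheory.IntegrableOn f (Iic T') := by
    have hexp : MeasureTheory.IntegrableOn (fun s ↦ C * ‖Real.exp (c * s)‖) (Iic T') :=
      ((integrableOn_exp_mul_Iic hc T').norm).const_mul C
    refine MeasureTheory.Integrable.mono' hexp
      ((hf.mono fun s hs ↦ lt_of_le_of_lt hs hT').aestronglyMeasurable measurableSet_Iic) ?_
    filter_upwards [MeasureTheory.ae_restrict_mem measurableSet_Iic] with s hs
    exact hT s (le_trans hs (min_le_left _ _))
  have h2 : MeasureTheory.IntegrableOn f (Icc T' t) :=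
    (hf.mono fun s hs ↦ lt_of_le_of_lt hs.2 ht).integrableOn_Icc
  rw [← Iic_union_Icc_eq_Iic (min_le_right T t)]
  exact h1.union h2

theorem hasDerivAt_lam (hcont : ContinuousOn a (Iio tmax))
    (hint : ∀ t < tmax, MeasureTheory.IntegrableOn a (Iic t)) {t : ℝ} (ht : t < tmax) :
    HasDerivAt (lam a) (a t) t := by
  have hca : ContinuousAt a t := hcont.continuousAt (Iio_mem_nhds ht)
  have h1 : HasDerivAt (fun u ↦ ∫ s in (t - 1)..u, a s) (a t) t := by
    refine intervalIntegral.integral_hasDerivAt_right ?_ ?_ hca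
    · refine ContinuousOn.intervalIntegrable (hcont.mono fun s hs ↦ ?_)
      rw [uIcc_of_le (by linarith)] at hs
      exact lt_of_le_of_lt hs.2 ht
    · exact hcont.stronglyMeasurableAtFilter isOpen_Iio t ht
  refine (h1.const_add (lam a (t - 1))).congr_of_eventuallyEq ?_
  filter_upwards [Iio_mem_nhds ht] with u hu
  rw [← intervalIntegral.integral_Iic_sub_Iic (hint _ (by linarith)) (hint u hu)]
  simp [lam]

theorem hasDerivAt_eta {tL : ℝ} (htL : tL < tmax) (hcont : ContinuousOn a (Iio tmax))
    (hpos : ∀ t < tmax, 0 < a t) {t : ℝ} (ht : t < tmax) :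
    HasDerivAt (eta a tL) (a t)⁻¹ t := by
  have hinv : ContinuousOn (fun s ↦ (a s)⁻¹) (Iio tmax) := hcont.inv₀ fun s hs ↦ (hpos s hs).ne'
  have h1 : HasDerivAt (fun u ↦ ∫ s in u..tL, (a s)⁻¹) (-(a t)⁻¹) t := by
    refine intervalIntegral.integral_hasDerivAt_left ?_ ?_ (hinv.continuousAt (Iio_mem_nhds ht))
    · refine ContinuousOn.intervalIntegrable (hinv.mono fun s hs ↦ ?_)
      exact lt_of_le_of_lt hs.2 (max_lt ht htL)
    · exact hinv.stronglyMeasurableAtFilter isOpen_Iio t ht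
  have h2 := h1.neg
  rw [neg_neg] at h2
  exact h2

theorem strictMonoOn_lam (hpos : ∀ t < tmax, 0 < a t)
    (hl : ∀ t < tmax, HasDerivAt (lam a) (a t) t) : StrictMonoOn (lam a) (Iio tmax) := by
  refine strictMonoOn_of_deriv_pos (convex_Iio _)
    (fun t ht ↦ (hl t ht).continuousAt.continuousWithinAt) fun t ht ↦ ?_
  rw [interior_Iio] at ht
  rw [(hl t ht).deriv]
  exact hpos t ht

theorem lam_pos (hpos : ∀ t < tmax, 0 < a t) (hl : ∀ t < tmax, HasDerivAt (lam a) (a t) t)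
    {t : ℝ} (ht : t < tmax) : 0 < lam a t := by
  have h1 : 0 ≤ lam a (t - 1) := MeasureTheory.setIntegral_nonneg measurableSet_Iic
    fun s hs ↦ (hpos s (by have : s ≤ t - 1 := hs; linarith)).le
  exact h1.trans_lt (strictMonoOn_lam hpos hl (by show t - 1 < tmax; linarith) ht (by linarith))

theorem tendsto_lam_atBot (hint : ∀ t < tmax, MeasureTheory.IntegrableOn a (Iic t)) :
    Tendsto (lam a) atBot (𝓝 0) := by
  have h := MeasureTheory.intervalIntegral_tendsto_integral_Iic (tmax - 1)
    (hint (tmax - 1) (by linarith)) tendsto_id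
  have h1 := (tendsto_const_nhds (x := lam a (tmax - 1))).sub h
  rw [show (∫ s in Iic (tmax - 1), a s) = lam a (tmax - 1) from rfl, sub_self] at h1
  refine h1.congr' ?_
  filter_upwards [Iio_mem_atBot tmax] with t ht
  rw [id, ← intervalIntegral.integral_Iic_sub_Iic (hint _ ht) (hint _ (by linarith))]
  simp [lam]

theorem exists_lam_eq (hint : ∀ t < tmax, MeasureTheory.IntegrableOn a (Iic t))
    (hl : ∀ t < tmax, HasDerivAt (lam a) (a t) t) {t₁ : ℝ} (ht₁ : t₁ < tmax) {x : ℝ} (hx : 0 < x)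
    (hx₁ : x < lam a t₁) : ∃ t < t₁, lam a t = x := by
  obtain ⟨s, hs, hst⟩ := (((tendsto_lam_atBot hint).eventually_lt_const hx).and
    (Iio_mem_atBot t₁)).exists
  obtain ⟨t, ht, htx⟩ := intermediate_value_Ioo (le_of_lt hst)
    (fun u hu ↦ (hl u (lt_of_le_of_lt hu.2 ht₁)).continuousAt.continuousWithinAt) ⟨hs, hx₁⟩
  exact ⟨t, ht.2, htx⟩

/-- The inverse function `t(λ)` of the coordinate `λ(t)`. -/
theorem exists_time_of_lam (hpos : ∀ t < tmax, 0 < a t)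
    (hint : ∀ t < tmax, MeasureTheory.IntegrableOn a (Iic t))
    (hl : ∀ t < tmax, HasDerivAt (lam a) (a t) t) {t₁ : ℝ} (ht₁ : t₁ < tmax) :
    ∃ τ : ℝ → ℝ, (∀ t < t₁, τ (lam a t) = t) ∧ (∀ x ∈ Ioo 0 (lam a t₁), τ x < t₁) ∧
      (∀ x ∈ Ioo 0 (lam a t₁), HasDerivAt τ (a (τ x))⁻¹ x) ∧ Tendsto τ (𝓝[>] 0) atBot := by
  have hmono := strictMonoOn_lam hpos hl
  choose! τ hτ₁ hτ using fun x (hx : x ∈ Ioo 0 (lam a t₁)) ↦ exists_lam_eq hint hl ht₁ hx.1 hx.2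
  have hmem {t : ℝ} (ht : t < t₁) : lam a t ∈ Ioo 0 (lam a t₁) :=
    ⟨lam_pos hpos hl (ht.trans ht₁), hmono (ht.trans ht₁) ht₁ ht⟩
  have hleft : ∀ t < t₁, τ (lam a t) = t := fun t ht ↦
    hmono.injOn ((hτ₁ _ (hmem ht)).trans ht₁) (ht.trans ht₁) (hτ _ (hmem ht))
  have hτmono : StrictMonoOn τ (Ioo 0 (lam a t₁)) := by
    intro x hx y hy hxy
    rw [← hmono.lt_iff_lt ((hτ₁ x hx).trans ht₁) ((hτ₁ y hy).trans ht₁), hτ x hx, hτ y hy]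
    exact hxy
  refine ⟨τ, hleft, hτ₁, fun x hx ↦ ?_, ?_⟩
  · have hc : ContinuousAt τ x := by
      refine hτmono.continuousAt_of_image_mem_nhds (Ioo_mem_nhds hx.1 hx.2) ?_
      refine mem_of_superset (Iio_mem_nhds (hτ₁ x hx)) fun t ht ↦ ⟨lam a t, hmem ht, hleft t ht⟩
    refine HasDerivAt.of_local_left_inverse hc (hl _ ((hτ₁ x hx).trans ht₁))
      (hpos _ ((hτ₁ x hx).trans ht₁)).ne' ?_
    filter_upwards [Ioo_mem_nhds hx.1 hx.2] with y hy using hτ y hy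
  · refine tendsto_atBot.2 fun T ↦ ?_
    have hT : min T (t₁ - 1) < t₁ := (min_le_right _ _).trans_lt (by linarith)
    filter_upwards [Ioo_mem_nhdsGT (hmem hT).1] with x hx
    have hx' : x ∈ Ioo 0 (lam a t₁) := ⟨hx.1, hx.2.trans (hmem hT).2⟩
    by_contra! h
    have h1 : min T (t₁ - 1) < τ x := (min_le_left _ _).trans_lt h
    have h2 := hmono (hT.trans ht₁) ((hτ₁ x hx').trans ht₁) h1
    rw [hτ x hx'] at h2
    exact (h2.trans hx.2).false

end Coordinates

/-! ### Asymptotics at `t → -∞` -/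

section Asymptotics

variable {a : ℝ → ℝ} {tmax tL h ε : ℝ}

theorem tendsto_exp_mul_atBot {c : ℝ} (hc : 0 < c) :
    Tendsto (fun t ↦ Real.exp (c * t)) atBot (𝓝 0) :=
  Real.tendsto_exp_atBot.comp (tendsto_id.const_mul_atBot hc)

theorem isLittleO_exp_of_isLittleO (hh : 0 < h) (hε : 0 < ε) {f : ℝ → ℝ}
    (hf : f =o[atBot] fun t ↦ Real.exp ((2 + ε) * h * t)) :
    f =o[atBot] fun t ↦ Real.exp (h * t) := by
  refine hf.trans_isBigO (IsBigO.of_bound 1 ?_)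
  filter_upwards [Iic_mem_atBot 0] with t ht
  rw [Real.norm_of_nonneg (Real.exp_pos _).le, Real.norm_of_nonneg (Real.exp_pos _).le, one_mul]
  refine Real.exp_le_exp.2 ?_
  have ht' : t ≤ 0 := ht
  have : (1 + ε) * h * t ≤ 0 := mul_nonpos_of_nonneg_of_nonpos (by positivity) ht'
  linarith

theorem isEquivalent_exp (hh : 0 < h) (hε : 0 < ε)
    (ha : (fun t ↦ a t - Real.exp (h * t)) =o[atBot] fun t ↦ Real.exp ((2 + ε) * h * t)) :
    a ~[atBot] fun t ↦ Real.exp (h * t) :=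
  isLittleO_exp_of_isLittleO hh hε ha

theorem tendsto_scale_atBot (hh : 0 < h) (ha : a ~[atBot] fun t ↦ Real.exp (h * t)) :
    Tendsto a atBot (𝓝 0) :=
  ha.symm.tendsto_nhds (tendsto_exp_mul_atBot hh)

theorem tendsto_hubble_atBot (hh : 0 < h) (hε : 0 < ε)
    (ha : a ~[atBot] fun t ↦ Real.exp (h * t))
    (ha' : (fun t ↦ deriv a t - h * Real.exp (h * t)) =o[atBot]
      fun t ↦ Real.exp ((2 + ε) * h * t)) :
    Tendsto (hubble a) atBot (𝓝 h) := by
  have h1 : deriv a ~[atBot] fun t ↦ h * Real.exp (h * t) :=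
    (isLittleO_exp_of_isLittleO hh hε ha').trans_isBigO
      ((isBigO_refl _ _).const_mul_right hh.ne')
  have h2 := h1.div ha
  refine h2.symm.tendsto_nhds (tendsto_const_nhds.congr fun t ↦ ?_)
  rw [Pi.div_apply]
  field_simp

/-- An error term `o(e^{(2+ε)ht})` is `o(e^{εht})` after division by `a(t) e^{ht}`. -/
theorem isLittleO_div_exp (ha : a ~[atBot] fun t ↦ Real.exp (h * t)) {f : ℝ → ℝ}
    (hf : f =o[atBot] fun t ↦ Real.exp ((2 + ε) * h * t)) :
    (fun t ↦ f t / (a t * Real.exp (h * t))) =o[atBot] fun t ↦ Real.exp (ε * h * t) := by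
  have h1 : (fun t ↦ (a t * Real.exp (h * t))⁻¹) =O[atBot]
      fun t ↦ (Real.exp (h * t) * Real.exp (h * t))⁻¹ :=
    ((ha.mul IsEquivalent.refl).inv).isBigO
  refine (hf.mul_isBigO h1).congr (fun t ↦ rfl) fun t ↦ ?_
  rw [← Real.exp_add, ← Real.exp_neg, ← Real.exp_add]
  ring_nf

/-- The integrand is `-(a - e^{hs}) / (a e^{hs})`. Its denominator is of order `e^{2hs}`, so the
exponent `2 + ε` leaves the integrable error `o(e^{εhs})`. -/
theorem integrableOn_inv_sub_exp (hh : 0 < h) (hε : 0 < ε) (hcont : ContinuousOn a (Iio tmax))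
    (hpos : ∀ t < tmax, 0 < a t)
    (ha : (fun t ↦ a t - Real.exp (h * t)) =o[atBot] fun t ↦ Real.exp ((2 + ε) * h * t))
    {t : ℝ} (ht : t < tmax) :
    MeasureTheory.IntegrableOn (fun s ↦ (a s)⁻¹ - (Real.exp (h * s))⁻¹) (Iic t) := by
  refine integrableOn_Iic_of_isBigO_exp (mul_pos hε hh) ?_ ht ?_
  · refine (hcont.inv₀ fun s hs ↦ (hpos s hs).ne').sub (Continuous.continuousOn ?_)
    exact Continuous.inv₀ (by fun_prop) fun s ↦ (Real.exp_pos _).ne'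
  · refine (isLittleO_div_exp (isEquivalent_exp hh hε ha) ha).isBigO.neg_left.congr' ?_
      EventuallyEq.rfl
    filter_upwards [Iio_mem_atBot tmax] with s hs
    have h1 := (hpos s hs).ne'
    have h2 := (Real.exp_pos (h * s)).ne'
    field_simp
    ring

/-- The function has derivative `1/a - e^{-ht}`, integrable at `-∞`, so it converges there. -/
theorem exists_tendsto_eta_add (hh : 0 < h) (hε : 0 < ε) (htL : tL < tmax)
    (hcont : ContinuousOn a (Iio tmax)) (hpos : ∀ t < tmax, 0 < a t)
    (ha : (fun t ↦ a t - Real.exp (h * t)) =o[atBot] fun t ↦ Real.exp ((2 + ε) * h * t)) :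
    ∃ c, Tendsto (fun t ↦ eta a tL t + (h * Real.exp (h * t))⁻¹) atBot (𝓝 c) := by
  refine ⟨_, MeasureTheory.tendsto_limUnder_of_hasDerivAt_of_integrableOn_Iic (a := tL)
    (fun t ht ↦ ?_) (integrableOn_inv_sub_exp hh hε hcont hpos ha htL)⟩
  have h1 := hasDerivAt_eta htL hcont hpos (lt_of_le_of_lt ht htL)
  have h2 : HasDerivAt (fun t ↦ h * Real.exp (h * t)) (h * (Real.exp (h * t) * (h * 1))) t :=
    (((hasDerivAt_id t).const_mul h).exp).const_mul h
  have h3 := (Real.exp_pos (h * t)).ne'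
  refine (h1.add (h2.inv (mul_ne_zero hh.ne' h3))).congr_deriv ?_
  field_simp
  ring

theorem tendsto_scale_mul_eta (hh : 0 < h) (ha : a ~[atBot] fun t ↦ Real.exp (h * t)) {c : ℝ}
    (hE : Tendsto (fun t ↦ eta a tL t + (h * Real.exp (h * t))⁻¹) atBot (𝓝 c)) :
    Tendsto (fun t ↦ a t * eta a tL t) atBot (𝓝 (-h⁻¹)) := by
  have h1 : Tendsto (fun t ↦ a t / Real.exp (h * t)) atBot (𝓝 1) :=
    (isEquivalent_iff_tendsto_one (Eventually.of_forall fun t ↦ (Real.exp_pos _).ne')).1 ha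
  -- Uses `a η = a (η + e^{-ht}/h) - (a/e^{ht})/h`.
  have h2 := ((tendsto_scale_atBot hh ha).mul hE).sub (h1.mul_const h⁻¹)
  rw [zero_mul, one_mul, zero_sub] at h2
  refine h2.congr fun t ↦ ?_
  rw [mul_inv]
  ring

/-- The divergent parts cancel through the identity `H η + 1/a = H (η + e^{-ht}/h) - (ȧ - h e^{ht})
/ (h a e^{ht})`, whose last term tends to `0`. -/
theorem tendsto_hubble_mul_eta_add_inv (hh : 0 < h) (hε : 0 < ε) (hpos : ∀ t < tmax, 0 < a t)
    (ha : a ~[atBot] fun t ↦ Real.exp (h * t))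
    (ha' : (fun t ↦ deriv a t - h * Real.exp (h * t)) =o[atBot]
      fun t ↦ Real.exp ((2 + ε) * h * t)) {c : ℝ}
    (hE : Tendsto (fun t ↦ eta a tL t + (h * Real.exp (h * t))⁻¹) atBot (𝓝 c)) :
    Tendsto (fun t ↦ hubble a t * eta a tL t + (a t)⁻¹) atBot (𝓝 (h * c)) := by
  have h1 := (isLittleO_div_exp ha ha').isBigO.trans_tendsto
    (tendsto_exp_mul_atBot (mul_pos hε hh))
  have h2 := ((tendsto_hubble_atBot hh hε ha ha').mul hE).sub (h1.mul_const h⁻¹)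
  rw [zero_mul, sub_zero] at h2
  refine h2.congr' ?_
  filter_upwards [Iio_mem_atBot tmax] with t ht
  have h3 := (hpos t ht).ne'
  have h4 := (Real.exp_pos (h * t)).ne'
  rw [hubble]
  field_simp
  ring

end Asymptotics

/-! ### The extension theorems -/

section Extension

variable {a : ℝ → ℝ} {tmax tL : ℝ}

theorem hasDerivAt_comp_time {τ f : ℝ → ℝ} {f' x : ℝ} (hτ : HasDerivAt τ (a (τ x))⁻¹ x)
    (hf : HasDerivAt f f' (τ x)) : HasDerivAt (fun x ↦ f (τ x)) (f' / a (τ x)) x :=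
  hf.comp x hτ

theorem hasDerivAt_scale_mul_eta {t : ℝ} (ha : 0 < a t) (hd : HasDerivAt a (deriv a t) t)
    (he : HasDerivAt (eta a tL) (a t)⁻¹ t) :
    HasDerivAt (fun t ↦ a t * eta a tL t) (a t * (hubble a t * eta a tL t + (a t)⁻¹)) t := by
  refine (hd.mul he).congr_deriv ?_
  rw [hubble]
  field_simp

/-- The term `H/a` from differentiating `η` cancels against `-ȧ/a²`. -/
theorem hasDerivAt_hubble_mul_eta_add_inv {t : ℝ} (ha : 0 < a t) (hd : HasDerivAt a (deriv a t) t)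
    (hH : HasDerivAt (hubble a) (deriv (hubble a) t) t)
    (he : HasDerivAt (eta a tL) (a t)⁻¹ t) :
    HasDerivAt (fun t ↦ hubble a t * eta a tL t + (a t)⁻¹) (deriv (hubble a) t * eta a tL t) t := by
  refine ((hH.mul he).add (hd.inv ha.ne')).congr_deriv ?_
  rw [hubble]
  field_simp
  ring

theorem contDiffOn_deriv_of_contDiffOn (hsmooth : ContDiffOn ℝ ∞ a (Iio tmax)) :
    ContDiffOn ℝ ∞ (deriv a) (Iio tmax) :=
  ((contDiffOn_infty_iff_deriv_of_isOpen isOpen_Iio).1 hsmooth).2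

theorem contDiffOn_hubble (hsmooth : ContDiffOn ℝ ∞ a (Iio tmax)) (hpos : ∀ t < tmax, 0 < a t) :
    ContDiffOn ℝ ∞ (hubble a) (Iio tmax) :=
  (contDiffOn_deriv_of_contDiffOn hsmooth).div hsmooth fun t ht ↦ (hpos t ht).ne'

theorem hasDerivAt_of_contDiffOn {f : ℝ → ℝ} (hf : ContDiffOn ℝ ∞ f (Iio tmax)) {t : ℝ}
    (ht : t < tmax) : HasDerivAt f (deriv f t) t :=
  ((hf.differentiableOn (by simp)).differentiableAt (Iio_mem_nhds ht)).hasDerivAt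

theorem continuousOn_comp_time {τ f : ℝ → ℝ} {b : ℝ} (hτ₁ : ∀ x ∈ Ioo 0 b, τ x < tmax)
    (hτ : ∀ x ∈ Ioo 0 b, HasDerivAt τ (a (τ x))⁻¹ x) (hf : ContinuousOn f (Iio tmax)) :
    ContinuousOn (fun x ↦ f (τ x)) (Ioo 0 b) :=
  hf.comp (fun x hx ↦ (hτ x hx).continuousAt.continuousWithinAt) hτ₁

/-- The extension criterion for extensions of `a` and `a η` by explicit functions on `λ ≤ 0`. -/
theorem admitsExtension_of_glue {k : WithTop ℕ∞} (htL : tL < tmax)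
    (hpos : ∀ t < tmax, 0 < a t) (hcont : ContinuousOn a (Iio tmax))
    (hint : ∀ t < tmax, MeasureTheory.IntegrableOn a (Iic t)) {p q : ℝ → ℝ}
    (hp₀ : p 0 = 0) (hq₀ : q 0 < 0)
    (hglue : ∀ (τ : ℝ → ℝ) (b : ℝ), 0 < b → (∀ x ∈ Ioo 0 b, τ x < tmax) →
      (∀ x ∈ Ioo 0 b, HasDerivAt τ (a (τ x))⁻¹ x) → Tendsto τ (𝓝[>] 0) atBot →
      ContDiffOn ℝ k (glue p fun x ↦ a (τ x)) (Iio b) ∧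
      ContDiffOn ℝ k (glue q fun x ↦ a (τ x) * eta a tL (τ x)) (Iio b)) :
    AdmitsExtensionThroughLamZero k tmax tL a := by
  have hl {t : ℝ} (ht : t < tmax) := hasDerivAt_lam hcont hint ht
  have hlpos {t : ℝ} (ht : t < tmax) := lam_pos hpos (fun t ↦ hl) ht
  -- The extension only concerns early times; `tL` serves as the cut-off `t₁`.
  obtain ⟨τ, hleft, hτ₁, hτ, hτ₀⟩ := exists_time_of_lam hpos hint (fun t ↦ hl) htL
  obtain ⟨hA, hF⟩ := hglue τ (lam a tL) (hlpos htL) (fun x hx ↦ (hτ₁ x hx).trans htL) hτ hτ₀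
  refine admitsExtension_of_contDiffOn htL hpos (fun t ↦ hl)
    (fun t ht ↦ hasDerivAt_eta htL hcont hpos ht)
    (fun s t hst ht ↦ strictMonoOn_lam hpos (fun t ↦ hl) (hst.trans ht) ht hst) (hlpos htL)
    (fun x hx hx₁ ↦ exists_lam_eq hint (fun t ↦ hl) htL hx hx₁) hA hF ?_ ?_ ?_ ?_
  · rw [glue_of_nonpos le_rfl, hp₀]
  · rwa [glue_of_nonpos le_rfl]
  · intro t ht
    rw [glue_of_pos (hlpos (ht.trans htL)), hleft t ht]
  · intro t ht
    rw [glue_of_pos (hlpos (ht.trans htL)), hleft t ht]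

variable {h c : ℝ}

theorem admitsExtension_one (htL : tL < tmax) (hh : 0 < h)
    (hsmooth : ContDiffOn ℝ ∞ a (Iio tmax)) (hpos : ∀ t < tmax, 0 < a t)
    (hint : ∀ t < tmax, MeasureTheory.IntegrableOn a (Iic t))
    (ha₀ : Tendsto a atBot (𝓝 0)) (hH₀ : Tendsto (hubble a) atBot (𝓝 h))
    (hF₀ : Tendsto (fun t ↦ a t * eta a tL t) atBot (𝓝 (-h⁻¹)))
    (hF'₀ : Tendsto (fun t ↦ hubble a t * eta a tL t + (a t)⁻¹) atBot (𝓝 c)) :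
    AdmitsExtensionThroughLamZero 1 tmax tL a := by
  have hcont := hsmooth.continuousOn
  have he {t : ℝ} (ht : t < tmax) := hasDerivAt_eta htL hcont hpos ht
  have hec : ContinuousOn (eta a tL) (Iio tmax) := fun t ht ↦ (he ht).continuousAt.continuousWithinAt
  have hHc := (contDiffOn_hubble hsmooth hpos).continuousOn
  -- First-order Taylor polynomials at `λ = 0`, read off from the limits of `a`, `H`, `a η` and `H η
  -- + 1/a`.
  refine admitsExtension_of_glue (p := fun x ↦ h * x) (q := fun x ↦ -h⁻¹ + c * x) htL hpos hcont
    hint (by simp) (by simpa using hh) fun τ b hb hτ₁ hτ hτ₀ ↦ ⟨?_, ?_⟩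
  · refine contDiffOn_one_glue (p' := fun _ ↦ h) (f' := fun x ↦ hubble a (τ x)) hb
      (fun x ↦ ?_) continuous_const (fun x hx ↦ ?_) (continuousOn_comp_time hτ₁ hτ hHc)
      ?_ (hH₀.comp hτ₀)
    · simpa using (hasDerivAt_id x).const_mul h
    · exact hasDerivAt_comp_time (hτ x hx) (hasDerivAt_of_contDiffOn hsmooth (hτ₁ x hx))
    · simpa [Function.comp_def] using ha₀.comp hτ₀
  · refine contDiffOn_one_glue (p' := fun _ ↦ c)
      (f' := fun x ↦ hubble a (τ x) * eta a tL (τ x) + (a (τ x))⁻¹) hb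
      (fun x ↦ ?_) continuous_const (fun x hx ↦ ?_)
      (continuousOn_comp_time (f := fun t ↦ hubble a t * eta a tL t + (a t)⁻¹) hτ₁ hτ
        ((hHc.mul hec).add (hcont.inv₀ fun t ht ↦ (hpos t ht).ne')))
      ?_ (hF'₀.comp hτ₀)
    · simpa using ((hasDerivAt_id x).const_mul c).const_add (-h⁻¹)
    · have hx' := hτ₁ x hx
      refine (hasDerivAt_comp_time (f := fun t ↦ a t * eta a tL t) (hτ x hx)
        (hasDerivAt_scale_mul_eta (hpos _ hx') (hasDerivAt_of_contDiffOn hsmooth hx')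
        (he hx'))).congr_deriv ?_
      rw [mul_div_cancel_left₀ _ (hpos _ hx').ne']
    · simpa [Function.comp_def] using hF₀.comp hτ₀

theorem admitsExtension_two (htL : tL < tmax) (hh : 0 < h)
    (hsmooth : ContDiffOn ℝ ∞ a (Iio tmax)) (hpos : ∀ t < tmax, 0 < a t)
    (hint : ∀ t < tmax, MeasureTheory.IntegrableOn a (Iic t))
    (ha₀ : Tendsto a atBot (𝓝 0)) (hH₀ : Tendsto (hubble a) atBot (𝓝 h))
    (hF₀ : Tendsto (fun t ↦ a t * eta a tL t) atBot (𝓝 (-h⁻¹)))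
    (hF'₀ : Tendsto (fun t ↦ hubble a t * eta a tL t + (a t)⁻¹) atBot (𝓝 c)) {l : ℝ}
    (hl : Tendsto (fun t ↦ deriv (hubble a) t / a t ^ 2) atBot (𝓝 l)) :
    AdmitsExtensionThroughLamZero 2 tmax tL a := by
  have hcont := hsmooth.continuousOn
  have he {t : ℝ} (ht : t < tmax) := hasDerivAt_eta htL hcont hpos ht
  have hec : ContinuousOn (eta a tL) (Iio tmax) := fun t ht ↦ (he ht).continuousAt.continuousWithinAt
  have hH := contDiffOn_hubble hsmooth hpos
  have hHc : ContinuousOn (deriv (hubble a)) (Iio tmax) :=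
    (contDiffOn_deriv_of_contDiffOn hH).continuousOn
  have hne : ∀ t ∈ Iio tmax, a t ≠ 0 := fun t ht ↦ (hpos t ht).ne'
  have hA'' : Tendsto (fun t ↦ deriv (hubble a) t / a t) atBot (𝓝 0) := by
    have h1 := hl.mul ha₀
    rw [mul_zero] at h1
    refine h1.congr' ?_
    filter_upwards [Iio_mem_atBot tmax] with t ht
    have := hne t ht
    field_simp
  have hF'' : Tendsto (fun t ↦ deriv (hubble a) t * eta a tL t / a t) atBot (𝓝 (-(l * h⁻¹))) := by
    have h1 := hl.mul hF₀
    rw [mul_neg] at h1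
    refine h1.congr' ?_
    filter_upwards [Iio_mem_atBot tmax] with t ht
    have := hne t ht
    field_simp
  -- Second-order Taylor polynomials; that of `a` has no quadratic term because `Ḣ/a → 0`.
  refine admitsExtension_of_glue (p := fun x ↦ h * x)
    (q := fun x ↦ -h⁻¹ + c * x + -(l * h⁻¹) / 2 * x ^ 2) htL hpos hcont
    hint (by simp) (by simpa using hh) fun τ b hb hτ₁ hτ hτ₀ ↦ ⟨?_, ?_⟩
  · refine contDiffOn_two_glue (p' := fun _ ↦ h) (p'' := fun _ ↦ 0)
      (f' := fun x ↦ hubble a (τ x)) (f'' := fun x ↦ deriv (hubble a) (τ x) / a (τ x)) hb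
      (fun x ↦ ?_) (fun x ↦ hasDerivAt_const x h) continuous_const
      (fun x hx ↦ ?_) (fun x hx ↦ ?_)
      (continuousOn_comp_time (f := fun t ↦ deriv (hubble a) t / a t) hτ₁ hτ (hHc.div hcont hne))
      ?_ (hH₀.comp hτ₀) (hA''.comp hτ₀)
    · simpa using (hasDerivAt_id x).const_mul h
    · exact hasDerivAt_comp_time (hτ x hx) (hasDerivAt_of_contDiffOn hsmooth (hτ₁ x hx))
    · exact hasDerivAt_comp_time (hτ x hx) (hasDerivAt_of_contDiffOn hH (hτ₁ x hx))
    · simpa [Function.comp_def] using ha₀.comp hτ₀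
  · refine contDiffOn_two_glue (p' := fun x ↦ c + -(l * h⁻¹) * x) (p'' := fun _ ↦ -(l * h⁻¹))
      (f' := fun x ↦ hubble a (τ x) * eta a tL (τ x) + (a (τ x))⁻¹)
      (f'' := fun x ↦ deriv (hubble a) (τ x) * eta a tL (τ x) / a (τ x)) hb
      (fun x ↦ ?_) (fun x ↦ ?_) continuous_const (fun x hx ↦ ?_) (fun x hx ↦ ?_)
      (continuousOn_comp_time (f := fun t ↦ deriv (hubble a) t * eta a tL t / a t) hτ₁ hτ
        ((hHc.mul hec).div hcont hne)) ?_ ?_ (hF''.comp hτ₀)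
    · refine ((((hasDerivAt_id x).const_mul c).const_add (-h⁻¹)).add
        (((hasDerivAt_id x).pow 2).const_mul (-(l * h⁻¹) / 2))).congr_deriv ?_
      simp
      ring
    · simpa using ((hasDerivAt_id x).const_mul (-(l * h⁻¹))).const_add c
    · have hx' := hτ₁ x hx
      refine (hasDerivAt_comp_time (f := fun t ↦ a t * eta a tL t) (hτ x hx)
        (hasDerivAt_scale_mul_eta (hpos _ hx') (hasDerivAt_of_contDiffOn hsmooth hx')
        (he hx'))).congr_deriv ?_
      rw [mul_div_cancel_left₀ _ (hpos _ hx').ne']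
    · have hx' := hτ₁ x hx
      exact hasDerivAt_comp_time (f := fun t ↦ hubble a t * eta a tL t + (a t)⁻¹) (hτ x hx)
        (hasDerivAt_hubble_mul_eta_add_inv (hpos _ hx') (hasDerivAt_of_contDiffOn hsmooth hx')
        (hasDerivAt_of_contDiffOn hH hx') (he hx'))
    · simpa [Function.comp_def] using hF₀.comp hτ₀
    · simpa [Function.comp_def] using hF'₀.comp hτ₀

end Extension

end FlatFLRW

/-! ### The main theorem: the limits supplied to the two extension results. -/

theorem theorem3p7 (tmax tL : ℝ) (htL : tL < tmax) (a : ℝ → ℝ)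
    (ha_smooth : ContDiffOn ℝ ∞ a (Set.Iio tmax))
    (ha_pos : ∀ t < tmax, 0 < a t)
    (h ε : ℝ) (hh : 0 < h) (hε : 0 < ε)
    (ha : (fun t ↦ a t - Real.exp (h * t)) =o[Filter.atBot]
      fun t ↦ Real.exp ((2 + ε) * h * t))
    (ha' : (fun t ↦ deriv a t - h * Real.exp (h * t)) =o[Filter.atBot]
      fun t ↦ Real.exp ((2 + ε) * h * t)) :
    FlatFLRW.AdmitsExtensionThroughLamZero 1 tmax tL a ∧
    ((∃ ℓ : ℝ, Filter.Tendsto (fun t ↦ deriv (FlatFLRW.hubble a) t / (a t) ^ 2)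
        Filter.atBot (nhds ℓ)) →
      FlatFLRW.AdmitsExtensionThroughLamZero 2 tmax tL a) := by
  have hcont := ha_smooth.continuousOn
  have hequiv := FlatFLRW.isEquivalent_exp hh hε ha
  have hint : ∀ t < tmax, MeasureTheory.IntegrableOn a (Set.Iic t) := fun t ht ↦
    FlatFLRW.integrableOn_Iic_of_isBigO_exp hh hcont ht hequiv.isBigO
  have ha₀ := FlatFLRW.tendsto_scale_atBot hh hequiv
  have hH₀ := FlatFLRW.tendsto_hubble_atBot hh hε hequiv ha'
  obtain ⟨c, hc⟩ := FlatFLRW.exists_tendsto_eta_add hh hε htL hcont ha_pos ha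
  have hF₀ := FlatFLRW.tendsto_scale_mul_eta hh hequiv hc
  have hF'₀ := FlatFLRW.tendsto_hubble_mul_eta_add_inv hh hε ha_pos hequiv ha' hc
  refine ⟨FlatFLRW.admitsExtension_one htL hh ha_smooth ha_pos hint ha₀ hH₀ hF₀ hF'₀, ?_⟩
  rintro ⟨l, hl⟩
  exact FlatFLRW.admitsExtension_two htL hh ha_smooth ha_pos hint ha₀ hH₀ hF₀ hF'₀ hl
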